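/- Let $m\ge 2$, $n\ge 2$, $N=\{1,\dots,n\}$, and let $\mathcal A=(a_{i_1i_2\cdots i_m})$ be a complex tensor of order $m$ and dimension $n$ ($i_1,\dots,i_m\in N$). For $i,j\in N$ with $j\ne i$ put $$r_i(\mathcal A)=\sum_{(i_2,\dots,i_m)\neq(i,\dots,i)}|a_{ii_2\cdots i_m}|,\qquad r_i^j(\mathcal A)=\sum_{(i_2,\dots,i_m)\neq(i,\dots,i),\,(j,\dots,j)}|a_{ii_2\cdots i_m}|=r_i(\mathcal A)-|a_{ij\cdots j}|.$$ The determinant $\det(\mathcal A)$ is the resultant of the ordered system of $n$ forms of degree $m-1$ in $x_1,\dots,x_n$ $$(\mathcal A x^{m-1})_i=\sum_{i_2,\dots,i_m\in N}a_{ii_2\cdots i_m}x_{i_2}\cdots x_{i_m},\qquad i\in N,$$ where the resultant is normalized to be $1$ at the system $x_1^{m-1},\dots,x_n^{m-1}$. Suppose that for all $i,j\in N$ with $j\neq i$, either $$\left(|a_{i\cdots i}|-r_i^j(\mathcal A)\right)|a_{j\cdots j}|>|a_{ij\cdots j}|\,r_j(\mathcal A),$$ or $$\left(|a_{i\cdots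 i}|+r_i^p(\mathcal A)\right)|a_{p\cdots p}|<|a_{ip\cdots p}|\left(2|a_{pi\cdots i}|-r_p(\mathcal A)\right)\quad\text{for some }p\in N,\ p\neq i.$$ Then $\det(\mathcal A)\neq 0$. -/

import Mathlib

noncomputable section

namespace TensorDet

open MvPolynomial

/-! ## The multivariate resultant of `n` forms in `n` variables

The resultant is built as in classical elimination theory (Hurwitz, van der Waerden, Jouanolou):
the inertia forms of the universal system of degrees `d 1, …, d n` form a principal ideal of the
ring of integer polynomials in the coefficients, and the resultant is the generator of this ideal
whose value at the system `x₁ ^ d 1, …, xₙ ^ d n` is `1`. -/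

/-- The exponents of the monomials of total degree `e` in `n` variables. -/
abbrev Expo (n e : ℕ) : Type :=
  {α : Fin n →₀ ℕ // α ∈ (Finset.univ : Finset (Fin n)).finsuppAntidiag e}

/-- The indices `(i, α)` of the indeterminate coefficients `u_{i, α}`, with `|α| = d i`. -/
abbrev CoeffIdx {n : ℕ} (d : Fin n → ℕ) : Type := Σ i : Fin n, Expo n (d i)

/-- The ring `ℤ[u_{i, α}]` of integer polynomials in the indeterminate coefficients. -/
abbrev CoeffRing {n : ℕ} (d : Fin n → ℕ) : Type := MvPolynomial (CoeffIdx d) ℤ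

/-- The universal form `∑_{|α| = d i} u_{i, α} x ^ α` of degree `d i`. -/
def universalForm {n : ℕ} (d : Fin n → ℕ) (i : Fin n) :
    MvPolynomial (Fin n) (CoeffRing d) :=
  ∑ α : Expo n (d i), monomial α.1 (X ⟨i, α⟩ : CoeffRing d)

/-- The ideal of inertia forms (of degree `0` in `x`): all `R ∈ ℤ[u]` such that, for some `k`,
every `x_j ^ k * R` lies in the ideal generated by the universal forms. -/
def inertiaIdeal {n : ℕ} (d : Fin n → ℕ) : Ideal (CoeffRing d) where
  carrier := {R | ∃ k : ℕ, ∀ j : Fin n,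
    X j ^ k * C R ∈ Ideal.span (Set.range (universalForm d))}
  zero_mem' := ⟨0, fun j => by simp⟩
  add_mem' := by
    rintro R S ⟨k, hk⟩ ⟨l, hl⟩
    refine ⟨k + l, fun j => ?_⟩
    have h1 := Ideal.mul_mem_left _ (X j ^ l) (hk j)
    have h2 := Ideal.mul_mem_left _ (X j ^ k) (hl j)
    have h := Ideal.add_mem _ h1 h2
    have e : (X j ^ (k + l) * C (R + S) : MvPolynomial (Fin n) (CoeffRing d)) =
        X j ^ l * (X j ^ k * C R) + X j ^ k * (X j ^ l * C S) := by
      rw [map_add]; ring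
    rw [e]; exact h
  smul_mem' := by
    rintro S R ⟨k, hk⟩
    refine ⟨k, fun j => ?_⟩
    have h := Ideal.mul_mem_left _ (C S) (hk j)
    have e : (X j ^ k * C (S • R) : MvPolynomial (Fin n) (CoeffRing d)) =
        C S * (X j ^ k * C R) := by
      rw [smul_eq_mul, map_mul]; ring
    rw [e]; exact h

/-- Every ideal of a Noetherian unique factorization domain has a greatest common divisor. -/
theorem exists_ideal_gcd {R : Type*} [CommRing R] [IsDomain R] [IsNoetherianRing R]
    [UniqueFactorizationMonoid R] (I : Ideal R) :
    ∃ g : R, ∀ D : R, D ∣ g ↔ ∀ a ∈ I, D ∣ a := by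
  classical
  obtain ⟨inst⟩ : Nonempty (NormalizedGCDMonoid R) := inferInstance
  obtain ⟨s, hs⟩ := IsNoetherian.noetherian I
  refine ⟨s.gcd id, fun D => ?_⟩
  rw [Finset.dvd_gcd_iff]
  constructor
  · intro h a ha
    have hle : I ≤ Ideal.span {D} := by
      rw [← hs]
      refine Submodule.span_le.2 fun b hb => ?_
      exact Ideal.mem_span_singleton.2 (h b hb)
    exact Ideal.mem_span_singleton.1 (hle ha)
  · intro h b hb
    exact h b (hs ▸ Submodule.subset_span hb)

/-- A greatest common divisor of the ideal of inertia forms. As this ideal is principal (for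
`n ≥ 1` and positive degrees), this is
a generator of it; it is determined up to sign. -/
def preResultant {n : ℕ} (d : Fin n → ℕ) : CoeffRing d :=
  Classical.choose (exists_ideal_gcd (inertiaIdeal d))

/-- The value of `R ∈ ℤ[u]` at the coefficients of the system `G₁, …, Gₙ`, where the `Gᵢ` are
forms of degree `d i` over a commutative ring `K`. -/
def evalAt {n : ℕ} (d : Fin n → ℕ) {K : Type*} [CommRing K] (R : CoeffRing d)
    (G : Fin n → MvPolynomial (Fin n) K) : K :=
  aeval (fun c : CoeffIdx d => (G c.1).coeff c.2.1) R

/-- The universal resultant of degrees `d 1, …, d n`. The factor is `1` or `-1`; it makes the value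
at `x₁ ^ d 1, …, xₙ ^ d n` equal to `1`. -/
def universalResultant {n : ℕ} (d : Fin n → ℕ) : CoeffRing d :=
  C (evalAt d (preResultant d) (fun i => (X i ^ d i : MvPolynomial (Fin n) ℤ))) * preResultant d

/-- The resultant of an ordered system `G₁, …, Gₙ` of forms of degrees `d 1, …, d n` in `n`
variables. -/
def resultant {n : ℕ} (d : Fin n → ℕ) {K : Type*} [CommRing K]
    (G : Fin n → MvPolynomial (Fin n) K) : K :=
  evalAt d (universalResultant d) G

/-! ## Tensors -/

/-- Complex tensors of order `m ≥ 1` and dimension `n`. The entry with indices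
`i₁, i₂, …, i_m` is `A i₁ t`, where `t` is the tuple `(i₂, …, i_m)`. In particular
`A i (fun _ => j)` is the entry `a_{i j ⋯ j}`. -/
abbrev Tensor (m n : ℕ) : Type := Fin n → (Fin (m - 1) → Fin n) → ℂ

/-- The form `(A x ^ (m - 1))_i = ∑ a_{i i₂ ⋯ i_m} x_{i₂} ⋯ x_{i_m}`, of degree `m - 1`. -/
def Tensor.form {m n : ℕ} (A : Tensor m n) (i : Fin n) : MvPolynomial (Fin n) ℂ :=
  ∑ t : Fin (m - 1) → Fin n, C (A i t) * ∏ k, X (t k)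

/-- The determinant of a tensor: the resultant of the ordered system `A x ^ (m - 1) = 0`. -/
def Tensor.det {m n : ℕ} (A : Tensor m n) : ℂ :=
  resultant (fun _ => m - 1) A.form

/-- `r_i(A)`: the sum of the moduli of all `a_{i i₂ ⋯ i_m}` with `(i₂, …, i_m) ≠ (i, …, i)`. -/
def Tensor.r {m n : ℕ} (A : Tensor m n) (i : Fin n) : ℝ :=
  ∑ t : Fin (m - 1) → Fin n with t ≠ (fun _ => i), ‖A i t‖

/-- `r_i^j(A)`: the sum of the moduli of all `a_{i i₂ ⋯ i_m}` with `(i₂, …, i_m)` different from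
`(i, …, i)` and from `(j, …, j)`. -/
def Tensor.rr {m n : ℕ} (A : Tensor m n) (i j : Fin n) : ℝ :=
  ∑ t : Fin (m - 1) → Fin n with t ≠ (fun _ => i) ∧ t ≠ (fun _ => j), ‖A i t‖

end TensorDet

end

/-!
A common zero `x ≠ 0` of the forms is excluded by looking at a coordinate `x_i` of largest modulus.
In the `i`-th form and in the `j`-th form, all monomials except `x_i ^ (m - 1)` and `x_j ^ (m - 1)`
are bounded in modulus by `|x_i| ^ (m - 1)`; eliminating `|x_j| ^ (m - 1)` between the two estimates
contradicts either of the two hypotheses, the first one by upper bounds and the second one by lower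
bounds.

That the resultant is nonzero when there is no nontrivial zero comes from the Nullstellensatz:
all monomials of some degree `D` then lie in the ideal of the forms, so the Macaulay matrix of
degree `D` has a nonzero maximal minor. By Cramer's rule the same minor of the universal system is
an inertia form, and it is a multiple of the resultant.
-/

namespace TensorDet

open MvPolynomial

section LinearAlgebra

variable {ι J : Type*}

theorem exists_det_ne_zero_of_span_eq_top [Fintype J] [DecidableEq J] {K : Type*} [Field K]
    (v : ι → J → K) (hv : Submodule.span K (Set.range v) = ⊤) :
    ∃ f : J → ι, (Matrix.of fun j => v (f j)).det ≠ 0 := by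
  obtain ⟨κ, a, -, hspan, hli⟩ := exists_linearIndependent' K v
  let b := Module.Basis.mk hli (hspan.trans hv).ge
  let e := b.indexEquiv (Pi.basisFun K J)
  have hrows : LinearIndependent K (Matrix.of fun j => v (a (e.symm j))).row :=
    hli.comp e.symm e.symm.injective
  rw [Matrix.linearIndependent_rows_iff_isUnit, Matrix.isUnit_iff_isUnit_det] at hrows
  exact ⟨fun j => a (e.symm j), hrows.ne_zero⟩

theorem det_smul_mem_span_range_row [Fintype J] [DecidableEq J] {R : Type*} [CommRing R]
    (M : Matrix J J R) (w : J → R) :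
    M.det • w ∈ Submodule.span R (Set.range M.row) := by
  have cramer : M.det • w = ∑ j, (Matrix.vecMul w M.adjugate) j • M.row j := by
    simp only [Matrix.row, ← Matrix.vecMul_eq_sum]
    rw [Matrix.vecMul_vecMul, Matrix.adjugate_mul, Matrix.vecMul_smul,
      Matrix.vecMul_one]
  rw [cramer]
  exact Submodule.sum_mem _ fun j _ => Submodule.smul_mem _ _ (Submodule.subset_span ⟨j, rfl⟩)

theorem exists_smul_mem_span_of_span_map_eq_top [Finite J] {R K : Type*} [CommRing R] [Field K]
    (φ : R →+* K) (v : ι → J → R) (hv : Submodule.span K (Set.range fun c => φ ∘ v c) = ⊤) :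
    ∃ r : R, φ r ≠ 0 ∧ ∀ w : J → R, r • w ∈ Submodule.span R (Set.range v) := by
  classical
  let _ := Fintype.ofFinite J
  obtain ⟨f, hf⟩ := exists_det_ne_zero_of_span_eq_top _ hv
  let M : Matrix J J R := Matrix.of fun j => v (f j)
  refine ⟨M.det, ?_, fun w => Submodule.span_mono ?_ (det_smul_mem_span_range_row M w)⟩
  · rw [RingHom.map_det]
    exact hf
  · rintro _ ⟨j, rfl⟩
    exact ⟨f j, rfl⟩

end LinearAlgebra

section HomogeneousIdeal

variable {σ R : Type*} [CommRing R]

theorem homogeneousComponent_mem_span {ι : Type*} {d : ι → ℕ} {F : ι → MvPolynomial σ R}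
    (hF : ∀ i, (F i).IsHomogeneous (d i)) (D : ℕ) {p : MvPolynomial σ R}
    (hp : p ∈ Ideal.span (Set.range F)) :
    homogeneousComponent D p ∈ Ideal.span (Set.range F) := by
  let _ : GradedAlgebra (homogeneousSubmodule σ R) := gradedAlgebra
  have hI : (Ideal.span (Set.range F)).IsHomogeneous (homogeneousSubmodule σ R) :=
    Ideal.homogeneous_span _ _ (Set.forall_mem_range.2 fun i => ⟨d i, hF i⟩)
  rw [← decomposition.decompose'_apply]
  exact hI D hp

theorem restrictScalars_span_range_eq_span_monomial_mul {ι : Type*} (F : ι → MvPolynomial σ R) :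
    (Ideal.span (Set.range F)).restrictScalars R =
      Submodule.span R (Set.range fun c : ι × (σ →₀ ℕ) => monomial c.2 1 * F c.1) := by
  have hmonomials : Submodule.span R (Set.range fun α : σ →₀ ℕ => monomial α (1 : R)) = ⊤ := by
    simpa only [coe_basisMonomials] using (basisMonomials σ R).span_eq
  rw [Ideal.span, ← Submodule.span_smul_of_span_eq_top hmonomials]
  congr 1
  ext p
  simpa [Set.mem_smul] using exists_comm

theorem exists_pow_idealOfVars_le_of_forall_eq_zero {ι K : Type*} [Finite σ] [Field K]
    [IsAlgClosed K] {F : ι → MvPolynomial σ K}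
    (h0 : ∀ x : σ → K, (∀ i, eval x (F i) = 0) → x = 0) :
    ∃ D, idealOfVars σ K ^ D ≤ Ideal.span (Set.range F) := by
  refine Ideal.exists_pow_le_of_le_radical_of_fg ?_ (idealOfVars_fg σ K)
  rw [← vanishingIdeal_zeroLocus_eq_radical (K := K), Ideal.span_le]
  rintro _ ⟨j, rfl⟩ x hx
  rw [zeroLocus_span] at hx
  have hx0 : x = 0 := h0 x fun i => by simpa [aeval_eq_eval] using hx (F i) ⟨i, rfl⟩
  simp [hx0]

end HomogeneousIdeal

section Macaulay

variable {n : ℕ} {R : Type*} [CommRing R]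

theorem mem_finsuppAntidiag_univ_iff_degree_eq {e : ℕ} {α : Fin n →₀ ℕ} :
    α ∈ (Finset.univ : Finset (Fin n)).finsuppAntidiag e ↔ α.degree = e := by
  rw [Finset.mem_finsuppAntidiag, Finsupp.degree_eq_sum]
  exact and_iff_left (Finset.subset_univ _)

theorem homogeneousComponent_eq_sum_expo (D : ℕ) (p : MvPolynomial (Fin n) R) :
    homogeneousComponent D p = ∑ α : Expo n D, monomial α.1 (p.coeff α.1) := by
  classical
  rw [Finset.sum_coe_sort _ fun α => monomial α (p.coeff α)]
  ext β
  rw [coeff_homogeneousComponent, coeff_sum]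
  simp only [coeff_monomial, Finset.sum_ite_eq', mem_finsuppAntidiag_univ_iff_degree_eq]

/-- The vector of the coefficients of a polynomial at the monomials of degree `D`. -/
noncomputable def coeffVec (D : ℕ) : MvPolynomial (Fin n) R →ₗ[R] (Expo n D → R) :=
  LinearMap.pi fun α => lcoeff R α.1

theorem coeffVec_apply (D : ℕ) (p : MvPolynomial (Fin n) R) (α : Expo n D) :
    coeffVec D p α = p.coeff α.1 :=
  rfl

theorem coeffVec_monomial_one (D : ℕ) (α : Expo n D) :
    coeffVec D (monomial α.1 (1 : R)) = Pi.single α 1 := by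
  classical
  ext β
  simp only [coeffVec_apply, coeff_monomial, Pi.single_apply, Subtype.ext_iff, eq_comm]

theorem homogeneousComponent_eq_of_coeffVec_eq {D : ℕ} {p q : MvPolynomial (Fin n) R}
    (h : coeffVec D p = coeffVec D q) : homogeneousComponent D p = homogeneousComponent D q := by
  rw [homogeneousComponent_eq_sum_expo, homogeneousComponent_eq_sum_expo]
  exact Finset.sum_congr rfl fun α _ => congrArg (monomial α.1) (congrFun h α)

/-- The rows of the Macaulay matrix of degree `D` of a system of forms: the row `(i, β)` holds the
coefficients of `x ^ β * F i`. The rows with `|β| + deg (F i) ≠ D` are zero and are admitted only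
to keep the index type simple. -/
noncomputable def macaulayRow {ι : Type*} (F : ι → MvPolynomial (Fin n) R) (D : ℕ)
    (c : ι × (Fin n →₀ ℕ)) : Expo n D → R :=
  coeffVec D (monomial c.2 1 * F c.1)

theorem span_macaulayRow {ι : Type*} (F : ι → MvPolynomial (Fin n) R) (D : ℕ) :
    Submodule.span R (Set.range (macaulayRow F D)) =
      ((Ideal.span (Set.range F)).restrictScalars R).map (coeffVec D) := by
  rw [restrictScalars_span_range_eq_span_monomial_mul, Submodule.map_span, ← Set.range_comp]
  rfl

theorem macaulayRow_map {ι S : Type*} [CommRing S] (φ : R →+* S)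
    (F : ι → MvPolynomial (Fin n) R) (D : ℕ) (c : ι × (Fin n →₀ ℕ)) :
    macaulayRow (fun i => map φ (F i)) D c = φ ∘ macaulayRow F D c := by
  ext α
  rw [Function.comp_apply, macaulayRow, macaulayRow, coeffVec_apply, coeffVec_apply, ← coeff_map,
    map_mul, map_monomial, φ.map_one]

theorem span_macaulayRow_eq_top {ι : Type*} {F : ι → MvPolynomial (Fin n) R} {D : ℕ}
    (hD : idealOfVars (Fin n) R ^ D ≤ Ideal.span (Set.range F)) :
    Submodule.span R (Set.range (macaulayRow F D)) = ⊤ := by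
  rw [span_macaulayRow, eq_top_iff, ← (Pi.basisFun R (Expo n D)).span_eq, Submodule.span_le]
  rintro _ ⟨α, rfl⟩
  refine ⟨monomial α.1 1, hD ?_, ?_⟩
  · rw [pow_idealOfVars_eq_span]
    exact Ideal.subset_span ⟨α.1, mem_finsuppAntidiag_univ_iff_degree_eq.1 α.2, rfl⟩
  · rw [coeffVec_monomial_one, Pi.basisFun_apply]

theorem mem_span_of_coeffVec_mem_span_macaulayRow {ι : Type*} {d : ι → ℕ}
    {F : ι → MvPolynomial (Fin n) R} (hF : ∀ i, (F i).IsHomogeneous (d i)) {D : ℕ}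
    {p : MvPolynomial (Fin n) R} (hp : p.IsHomogeneous D)
    (h : coeffVec D p ∈ Submodule.span R (Set.range (macaulayRow F D))) :
    p ∈ Ideal.span (Set.range F) := by
  rw [span_macaulayRow] at h
  obtain ⟨q, hq, hqp⟩ := h
  rw [← homogeneousComponent_eq_self hp, ← homogeneousComponent_eq_of_coeffVec_eq hqp]
  exact homogeneousComponent_mem_span hF D hq

end Macaulay

section Resultant

variable {n : ℕ} {d : Fin n → ℕ} {K : Type*}

theorem universalForm_isHomogeneous (i : Fin n) : (universalForm d i).IsHomogeneous (d i) :=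
  IsHomogeneous.sum _ _ _ fun α _ =>
    isHomogeneous_monomial _ (mem_finsuppAntidiag_univ_iff_degree_eq.1 α.2)

/-- The specialization of the indeterminate coefficients to those of a given system, that is,
`evalAt` as a ring homomorphism. -/
noncomputable def specialization [CommRing K] (d : Fin n → ℕ) (F : Fin n → MvPolynomial (Fin n) K) :
    CoeffRing d →+* K :=
  (aeval (R := ℤ) fun c : CoeffIdx d => (F c.1).coeff c.2.1).toRingHom

theorem specialization_apply [CommRing K] (F : Fin n → MvPolynomial (Fin n) K) (P : CoeffRing d) :
    specialization d F P = evalAt d P F :=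
  rfl

theorem specialization_X [CommRing K] (F : Fin n → MvPolynomial (Fin n) K) (c : CoeffIdx d) :
    specialization d F (X c) = (F c.1).coeff c.2.1 :=
  aeval_X _ c

theorem map_specialization_universalForm [CommRing K] {F : Fin n → MvPolynomial (Fin n) K}
    {i : Fin n} (hF : (F i).IsHomogeneous (d i)) :
    map (specialization d F) (universalForm d i) = F i := by
  rw [universalForm, map_sum]
  simp only [map_monomial, specialization_X]
  rw [← homogeneousComponent_eq_sum_expo, homogeneousComponent_eq_self hF]

theorem evalAt_map [CommRing K] {L : Type*} [CommRing L] (φ : K →+* L) (P : CoeffRing d)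
    (F : Fin n → MvPolynomial (Fin n) K) :
    evalAt d P (fun i => map φ (F i)) = φ (evalAt d P F) := by
  have h : specialization d (fun i => map φ (F i)) = φ.comp (specialization d F) :=
    ringHom_ext' (RingHom.ext_int _ _) fun c => by
      simp only [RingHom.comp_apply, specialization_X, coeff_map]
  exact congrArg (· P) h

theorem exists_mem_inertiaIdeal_evalAt_ne_zero [Field K] {F : Fin n → MvPolynomial (Fin n) K}
    (hF : ∀ i, (F i).IsHomogeneous (d i)) {D : ℕ}
    (hD : idealOfVars (Fin n) K ^ D ≤ Ideal.span (Set.range F)) :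
    ∃ P ∈ inertiaIdeal d, evalAt d P F ≠ 0 := by
  have htop : Submodule.span K (Set.range fun c =>
      specialization d F ∘ macaulayRow (universalForm d) D c) = ⊤ := by
    simp_rw [← macaulayRow_map, map_specialization_universalForm (hF _)]
    exact span_macaulayRow_eq_top hD
  obtain ⟨P, hPF, hP⟩ := exists_smul_mem_span_of_span_map_eq_top _ _ htop
  refine ⟨P, ⟨D, fun j => ?_⟩, hPF⟩
  rw [mul_comm, ← smul_eq_C_mul]
  refine mem_span_of_coeffVec_mem_span_macaulayRow universalForm_isHomogeneous
    ((homogeneousSubmodule _ _ D).smul_mem P (isHomogeneous_X_pow j D)) ?_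
  rw [map_smul]
  exact hP _

theorem preResultant_dvd {P : CoeffRing d} (hP : P ∈ inertiaIdeal d) : preResultant d ∣ P :=
  (Classical.choose_spec (exists_ideal_gcd (inertiaIdeal d)) (preResultant d)).1 dvd_rfl P hP

theorem evalAt_preResultant_ne_zero [Field K] [IsAlgClosed K] {F : Fin n → MvPolynomial (Fin n) K}
    (hF : ∀ i, (F i).IsHomogeneous (d i)) (h0 : ∀ x : Fin n → K, (∀ i, eval x (F i) = 0) → x = 0) :
    evalAt d (preResultant d) F ≠ 0 := by
  obtain ⟨D, hD⟩ := exists_pow_idealOfVars_le_of_forall_eq_zero h0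
  obtain ⟨P, hP, hPF⟩ := exists_mem_inertiaIdeal_evalAt_ne_zero hF hD
  exact ne_zero_of_dvd_ne_zero hPF (map_dvd (specialization d F) (preResultant_dvd hP))

theorem resultant_eq_mul [CommRing K] (F : Fin n → MvPolynomial (Fin n) K) :
    resultant d F =
      evalAt d (preResultant d) (fun i => X i ^ d i) * evalAt d (preResultant d) F := by
  have hX : evalAt d (preResultant d) (fun i => (X i ^ d i : MvPolynomial (Fin n) K)) =
      (evalAt d (preResultant d) fun i => (X i ^ d i : MvPolynomial (Fin n) ℤ) : ℤ) := by
    simpa using evalAt_map (Int.castRingHom K) (preResultant d) fun i => X i ^ d i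
  rw [hX, resultant, universalResultant, evalAt, map_mul, algHom_C, eq_intCast]
  rfl

theorem resultant_ne_zero_of_forall_eq_zero [Field K] [IsAlgClosed K] (hd : ∀ i, d i ≠ 0)
    {F : Fin n → MvPolynomial (Fin n) K} (hF : ∀ i, (F i).IsHomogeneous (d i))
    (h0 : ∀ x : Fin n → K, (∀ i, eval x (F i) = 0) → x = 0) :
    resultant d F ≠ 0 := by
  rw [resultant_eq_mul]
  refine mul_ne_zero (evalAt_preResultant_ne_zero (fun i => isHomogeneous_X_pow i (d i))
    fun x hx => funext fun i => ?_) (evalAt_preResultant_ne_zero hF h0)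
  simpa [hd i] using hx i

end Resultant

theorem sum_filter_ne_eq_add {α M : Type*} [Fintype α] [DecidableEq α] [AddCommMonoid M] {a b : α}
    (hab : b ≠ a) (f : α → M) :
    ∑ t with t ≠ a, f t = f b + ∑ t with t ≠ a ∧ t ≠ b, f t := by
  rw [← Finset.filter_filter, Finset.filter_ne' _ b, Finset.add_sum_erase _ _ (by simpa using hab)]

theorem exists_ne_zero_forall_norm_le {ι E : Type*} [Finite ι] [NormedAddCommGroup E] {x : ι → E}
    (hx : x ≠ 0) : ∃ i, x i ≠ 0 ∧ ∀ k, ‖x k‖ ≤ ‖x i‖ := by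
  obtain ⟨k, hk⟩ := Function.ne_iff.1 hx
  have : Nonempty ι := ⟨k⟩
  obtain ⟨i, hi⟩ := Finite.exists_max fun l => ‖x l‖
  exact ⟨i, norm_pos_iff.1 ((norm_pos_iff.2 hk).trans_le (hi k)), hi⟩

theorem const_ne_const {m : ℕ} (hm : 2 ≤ m) {α : Type*} {i j : α} (hij : j ≠ i) :
    (fun _ : Fin (m - 1) => j) ≠ fun _ => i :=
  fun h => hij (congrFun h ⟨0, by omega⟩)

namespace Tensor

variable {m n : ℕ} (A : Tensor m n)

theorem form_isHomogeneous (i : Fin n) : (A.form i).IsHomogeneous (m - 1) := by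
  refine IsHomogeneous.sum _ _ _ fun t _ => ?_
  have h := (isHomogeneous_C (Fin n) (A i t)).mul
    (IsHomogeneous.prod Finset.univ (fun k => X (t k)) _ fun k _ => isHomogeneous_X ℂ (t k))
  simpa using h

theorem eval_form (i : Fin n) (x : Fin n → ℂ) :
    eval x (A.form i) = ∑ t : Fin (m - 1) → Fin n, A i t * ∏ k, x (t k) := by
  simp only [form, map_sum, map_mul, map_prod, eval_C, eval_X]

theorem det_ne_zero_of_forall_eq_zero (hm : 2 ≤ m)
    (h0 : ∀ x : Fin n → ℂ, (∀ i, eval x (A.form i) = 0) → x = 0) : A.det ≠ 0 :=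
  resultant_ne_zero_of_forall_eq_zero (fun _ => by omega) A.form_isHomogeneous h0

theorem r_eq_norm_add_rr (hm : 2 ≤ m) {i j : Fin n} (hij : j ≠ i) :
    A.r i = ‖A i fun _ => j‖ + A.rr i j :=
  sum_filter_ne_eq_add (const_ne_const hm hij) _

variable {A} {x : Fin n → ℂ} {i j : Fin n}

theorem norm_add_le_of_eval_form_eq_zero (hm : 2 ≤ m) (hij : j ≠ i) {M : ℝ}
    (hM : ∀ k, ‖x k‖ ≤ M) (hx : eval x (A.form i) = 0) :
    ‖(A i fun _ => i) * x i ^ (m - 1) + (A i fun _ => j) * x j ^ (m - 1)‖ ≤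
      A.rr i j * M ^ (m - 1) := by
  rw [eval_form, ← Finset.add_sum_erase _ _ (Finset.mem_univ fun _ => i), ← Finset.filter_ne',
    sum_filter_ne_eq_add (const_ne_const hm hij), ← add_assoc] at hx
  simp only [Finset.prod_const, Finset.card_univ, Fintype.card_fin] at hx
  rw [eq_neg_of_add_eq_zero_left hx, norm_neg, rr, Finset.sum_mul]
  refine norm_sum_le_of_le _ fun t _ => ?_
  rw [norm_mul, norm_prod]
  gcongr
  calc ∏ k, ‖x (t k)‖ ≤ ∏ _k : Fin (m - 1), M :=
        Finset.prod_le_prod (fun _ _ => norm_nonneg _) fun k _ => hM (t k)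
    _ = M ^ (m - 1) := by rw [Finset.prod_const, Finset.card_univ, Fintype.card_fin]

theorem abs_sub_le_of_eval_form_eq_zero (hm : 2 ≤ m) (hij : j ≠ i) {M : ℝ}
    (hM : ∀ k, ‖x k‖ ≤ M) (hx : eval x (A.form i) = 0) :
    |‖A i fun _ => i‖ * ‖x i‖ ^ (m - 1) - ‖A i fun _ => j‖ * ‖x j‖ ^ (m - 1)| ≤
      A.rr i j * M ^ (m - 1) := by
  refine le_trans ?_ (norm_add_le_of_eval_form_eq_zero hm hij hM hx)
  simpa only [norm_neg, norm_mul, norm_pow, sub_neg_eq_add] using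
    abs_norm_sub_norm_le ((A i fun _ => i) * x i ^ (m - 1)) (-((A i fun _ => j) * x j ^ (m - 1)))

theorem norm_sub_rr_mul_norm_le (hm : 2 ≤ m) (hij : j ≠ i) (hxi : x i ≠ 0)
    (hmax : ∀ k, ‖x k‖ ≤ ‖x i‖) (hi : eval x (A.form i) = 0) (hj : eval x (A.form j) = 0) :
    (‖A i fun _ => i‖ - A.rr i j) * ‖A j fun _ => j‖ ≤ ‖A i fun _ => j‖ * A.r j := by
  have row_i : (‖A i fun _ => i‖ - A.rr i j) * ‖x i‖ ^ (m - 1) ≤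
      ‖A i fun _ => j‖ * ‖x j‖ ^ (m - 1) := by
    linarith [(abs_le.1 (abs_sub_le_of_eval_form_eq_zero hm hij hmax hi)).2]
  have row_j : ‖A j fun _ => j‖ * ‖x j‖ ^ (m - 1) ≤ A.r j * ‖x i‖ ^ (m - 1) := by
    rw [r_eq_norm_add_rr A hm hij.symm]
    linarith [(abs_le.1 (abs_sub_le_of_eval_form_eq_zero hm hij.symm hmax hj)).2]
  refine le_of_mul_le_mul_right ?_ (pow_pos (norm_pos_iff.2 hxi) (m - 1))
  calc (‖A i fun _ => i‖ - A.rr i j) * ‖A j fun _ => j‖ * ‖x i‖ ^ (m - 1)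
      = (‖A i fun _ => i‖ - A.rr i j) * ‖x i‖ ^ (m - 1) * ‖A j fun _ => j‖ := by ring
    _ ≤ ‖A i fun _ => j‖ * ‖x j‖ ^ (m - 1) * ‖A j fun _ => j‖ := by gcongr
    _ = ‖A i fun _ => j‖ * (‖A j fun _ => j‖ * ‖x j‖ ^ (m - 1)) := by ring
    _ ≤ ‖A i fun _ => j‖ * (A.r j * ‖x i‖ ^ (m - 1)) := by gcongr
    _ = ‖A i fun _ => j‖ * A.r j * ‖x i‖ ^ (m - 1) := by ring

theorem norm_mul_two_mul_norm_sub_r_le (hm : 2 ≤ m) (hij : j ≠ i) (hxi : x i ≠ 0)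
    (hmax : ∀ k, ‖x k‖ ≤ ‖x i‖) (hi : eval x (A.form i) = 0) (hj : eval x (A.form j) = 0) :
    ‖A i fun _ => j‖ * (2 * ‖A j fun _ => i‖ - A.r j) ≤
      (‖A i fun _ => i‖ + A.rr i j) * ‖A j fun _ => j‖ := by
  have row_i : ‖A i fun _ => j‖ * ‖x j‖ ^ (m - 1) ≤
      (‖A i fun _ => i‖ + A.rr i j) * ‖x i‖ ^ (m - 1) := by
    linarith [(abs_le.1 (abs_sub_le_of_eval_form_eq_zero hm hij hmax hi)).1]
  have row_j : (2 * ‖A j fun _ => i‖ - A.r j) * ‖x i‖ ^ (m - 1) ≤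
      ‖A j fun _ => j‖ * ‖x j‖ ^ (m - 1) := by
    rw [r_eq_norm_add_rr A hm hij.symm]
    linarith [(abs_le.1 (abs_sub_le_of_eval_form_eq_zero hm hij.symm hmax hj)).1]
  refine le_of_mul_le_mul_right ?_ (pow_pos (norm_pos_iff.2 hxi) (m - 1))
  calc ‖A i fun _ => j‖ * (2 * ‖A j fun _ => i‖ - A.r j) * ‖x i‖ ^ (m - 1)
      = ‖A i fun _ => j‖ * ((2 * ‖A j fun _ => i‖ - A.r j) * ‖x i‖ ^ (m - 1)) := by ring
    _ ≤ ‖A i fun _ => j‖ * (‖A j fun _ => j‖ * ‖x j‖ ^ (m - 1)) := by gcongr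
    _ = ‖A i fun _ => j‖ * ‖x j‖ ^ (m - 1) * ‖A j fun _ => j‖ := by ring
    _ ≤ (‖A i fun _ => i‖ + A.rr i j) * ‖x i‖ ^ (m - 1) * ‖A j fun _ => j‖ := by gcongr
    _ = (‖A i fun _ => i‖ + A.rr i j) * ‖A j fun _ => j‖ * ‖x i‖ ^ (m - 1) := by ring

end Tensor

end TensorDet

theorem mainTheorem4_general {m n : ℕ} (hm : 2 ≤ m) (A : TensorDet.Tensor m n)
    (hA : ∀ i : Fin n, ∃ j, j ≠ i ∧
      ((‖A i (fun _ => i)‖ - A.rr i j) * ‖A j (fun _ => j)‖ > ‖A i (fun _ => j)‖ * A.r j ∨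
        (‖A i (fun _ => i)‖ + A.rr i j) * ‖A j (fun _ => j)‖ <
          ‖A i (fun _ => j)‖ * (2 * ‖A j (fun _ => i)‖ - A.r j))) :
    A.det ≠ 0 := by
  refine A.det_ne_zero_of_forall_eq_zero hm fun x hx => ?_
  by_contra hx0
  obtain ⟨i, hxi, hmax⟩ := TensorDet.exists_ne_zero_forall_norm_le hx0
  obtain ⟨j, hij, h | h⟩ := hA i
  · exact h.not_ge (TensorDet.Tensor.norm_sub_rr_mul_norm_le hm hij hxi hmax (hx i) (hx j))
  · exact h.not_ge (TensorDet.Tensor.norm_mul_two_mul_norm_sub_r_le hm hij hxi hmax (hx i) (hx j))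

theorem mainTheorem4 (m n : ℕ) (hm : 2 ≤ m) (hn : 2 ≤ n) (A : TensorDet.Tensor m n)
    (hA : ∀ i j : Fin n, j ≠ i →
      (‖A i (fun _ => i)‖ - A.rr i j) * ‖A j (fun _ => j)‖ > ‖A i (fun _ => j)‖ * A.r j ∨
      ∃ p : Fin n, p ≠ i ∧
        (‖A i (fun _ => i)‖ + A.rr i p) * ‖A p (fun _ => p)‖ <
          ‖A i (fun _ => p)‖ * (2 * ‖A p (fun _ => i)‖ - A.r p)) :
    A.det ≠ 0 := by
  have : Nontrivial (Fin n) := Fin.nontrivial_iff_two_le.2 hn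
  exact mainTheorem4_general hm A fun i => let ⟨j, hj⟩ := exists_ne i
    (hA i j hj).elim (fun h => ⟨j, hj, .inl h⟩) fun ⟨p, hp, h⟩ => ⟨p, hp, .inr h⟩
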